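/- There are absolute constants $C,c>0$ such that the following holds. Let $n\ge 2$ and $s\ge n$ be integers. Let $\mathcal{D}(\mathbf{C}^n)$ be the set of states on $\mathbf{C}^n$ (positive semidefinite $n\times n$ matrices of trace one), and let $\mu_{n,s}$ be the distribution of the partial trace over $\mathbf{C}^s$ of $|\psi\rangle\langle\psi|$, where $\psi$ is uniformly distributed on the unit sphere of $\mathbf{C}^n\otimes\mathbf{C}^s$. Let $K\subset\mathcal{D}(\mathbf{C}^n)$ be a convex body (a compact convex set with non-empty interior relative to the hyperplane $\mathcal{M}_n^{sa,1}$ of self-adjoint $n\times n$ matrices of trace one) containing $\mathrm{Id}/n$ in its relative interior, and let $r>0$ be its inradius about $\mathrm{Id}/n$, i.e. the largest radius of a Hilbert–Schmidt ball of $\mathcal{M}_n^{sa,1}$ centred at $\mathrm{Id}/n$ and contained in $K$. Put $K_0=K-\mathrm{Id}/n$ and $\|x\|_{K_0}=\inf\{t\ge 0 : x\in tK_0\}$. Let $\rho$ be a random state with distribution $\mu_{n,s}$, and let $M$ be a median of $\|\rho-\mathrm{Id}/n\|_{K_0}$. Then, for every $\eta>0$, \[ \mathbf{P}\left(\left|\,\Big\|\rho-\frac{\mathrm{Id}}{n}\Big\|_{K_0}-M\right|\ge\eta\right)\le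 C\left(\exp(-cs)+\exp(-c\,n^2 s\,r^2\eta^2)\right). \] -/

import Mathlib

open MeasureTheory ProbabilityTheory
open scoped ENNReal Matrix ComplexOrder

noncomputable section

namespace RandomState

/-- Complex `n × n` matrices, i.e. operators on `ℂⁿ`. -/
abbrev Mat (n : ℕ) : Type := Matrix (Fin n) (Fin n) ℂ

/-- The (Borel) product sigma-algebra on complex `n × n` matrices. -/
instance matMeasurableSpace (n : ℕ) : MeasurableSpace (Mat n) :=
  inferInstanceAs (MeasurableSpace (Fin n → Fin n → ℂ))

/-- The Hilbert–Schmidt norm `(tr (A A†))^{1/2}`. -/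
def hsNorm {n : ℕ} (A : Mat n) : ℝ := Real.sqrt (Matrix.trace (A * Aᴴ)).re

/-- The quantum states on `ℂⁿ`: positive semidefinite matrices of trace one. -/
def states (n : ℕ) : Set (Mat n) := {ρ | ρ.PosSemidef ∧ ρ.trace = 1}

/-- The real affine hyperplane of self-adjoint matrices of trace one. -/
def saTraceOne (n : ℕ) : Set (Mat n) := {A | A.IsHermitian ∧ A.trace = 1}

/-- The maximally mixed state `Id / n`. -/
def maxMixed (n : ℕ) : Mat n := (n : ℂ)⁻¹ • (1 : Mat n)

/-- The closed Hilbert–Schmidt ball with centre `x` and radius `t` in the hyperplane of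
self-adjoint matrices of trace one. -/
def hsBall {n : ℕ} (x : Mat n) (t : ℝ) : Set (Mat n) :=
  {A | A ∈ saTraceOne n ∧ hsNorm (A - x) ≤ t}

/-- `K` is a convex body contained in the set of states: a compact convex set of states with
non-empty interior relative to the hyperplane of self-adjoint matrices of trace one. -/
structure IsStateBody {n : ℕ} (K : Set (Mat n)) : Prop where
  subset_states : K ⊆ states n
  convex : Convex ℝ K
  isCompact : IsCompact K
  interior_nonempty : ∃ x ∈ K, ∃ t : ℝ, 0 < t ∧ hsBall x t ⊆ K

/-- `r` is the inradius of `K` about `Id / n`: the largest radius of a Euclidean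
(Hilbert–Schmidt) ball centred at `Id / n` and contained in `K`. -/
def IsInradiusAtMaxMixed {n : ℕ} (K : Set (Mat n)) (r : ℝ) : Prop :=
  IsGreatest {t : ℝ | 0 ≤ t ∧ hsBall (maxMixed n) t ⊆ K} r

/-- The translate `K₀ = K - Id / n`. -/
def recenter {n : ℕ} (K : Set (Mat n)) : Set (Mat n) := (fun A => A - maxMixed n) '' K

/-- The Hilbert space `ℂⁿ ⊗ ℂˢ`, in the coordinates of the product basis. -/
abbrev Bipartite (n s : ℕ) : Type := EuclideanSpace ℂ (Fin n × Fin s)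

/-- The uniform probability measure on the unit sphere of `ℂⁿ ⊗ ℂˢ`: normalized surface measure
(for `n * s ≠ 0`). -/
def sphereUniform (n s : ℕ) : Measure (Metric.sphere (0 : Bipartite n s) 1) :=
  ((volume : Measure (Bipartite n s)).toSphere Set.univ)⁻¹ •
    (volume : Measure (Bipartite n s)).toSphere

/-- The operator `|ψ⟩⟨ψ|` on `ℂⁿ ⊗ ℂˢ`. -/
def pureState {n s : ℕ} (ψ : Bipartite n s) : Matrix (Fin n × Fin s) (Fin n × Fin s) ℂ :=
  Matrix.of fun p q => ψ p * star (ψ q)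

/-- The partial trace over `ℂˢ` of an operator on `ℂⁿ ⊗ ℂˢ`. -/
def partialTrace {n s : ℕ} (X : Matrix (Fin n × Fin s) (Fin n × Fin s) ℂ) : Mat n :=
  Matrix.of fun i j => ∑ k : Fin s, X (i, k) (j, k)

/-- The induced measure `μ_{n,s}`: the law of the partial trace over `ℂˢ` of `|ψ⟩⟨ψ|`, for `ψ`
uniformly distributed on the unit sphere of `ℂⁿ ⊗ ℂˢ`. -/
def inducedMeasure (n s : ℕ) : Measure (Mat n) :=
  (sphereUniform n s).map fun ψ : Metric.sphere (0 : Bipartite n s) 1 =>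
    partialTrace (pureState (ψ : Bipartite n s))

/-- `M` is a median of the real random variable `X` under `P`. -/
def IsMedian {Ω : Type*} [MeasurableSpace Ω] (P : Measure Ω) (X : Ω → ℝ) (M : ℝ) : Prop :=
  1 / 2 ≤ P {ω | X ω ≤ M} ∧ 1 / 2 ≤ P {ω | M ≤ X ω}

end RandomState

end

/-!
The proof is a local form of Lévy's lemma, in which a median is controlled by an isoperimetric
estimate for two sets.

*Concentration.* If `A` and `B` are subsets of the unit ball of a Euclidean space of dimension `d`
at distance at least `δ`, then by the parallelogram law all midpoints between them lie in the ball
of radius `√(1 - δ² / 4)`. The multiplicative Brunn–Minkowski inequality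
(`measure_mul_measure_le_of_midpoint`, deduced from the Prékopa–Leindler inequality) bounds the
product of their volumes by `exp (-d δ² / 4)` times the square of the volume of the ball. Radial
thickening turns this into `sphereUniform_mul_sphereUniform_le` on the sphere of `ℂⁿ ⊗ ℂˢ`, of real
dimension `2 n s`.

*Lipschitz estimate.* A vector `ψ` is the same as an operator `vecOp ψ : ℂˢ → ℂⁿ` whose matrix `A`
satisfies `tr_{ℂˢ} |ψ⟩⟨ψ| = A A†`. From `A A† - B B† = A (A - B)† + (A - B) B†` the reduced state is
`2 L`-Lipschitz in Hilbert–Schmidt norm on the set where the operator norm is at most `L`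
(`hsNorm_partialTrace_sub_le`), and the gauge of `K₀` is `1 / r`-Lipschitz on the hyperplane of
self-adjoint matrices of trace one (`gauge_recenter_sub_le`).

*Operator norm.* For `s ≥ n` the operator norm is at most `40 / √n` outside a set of measure
`8 exp (-s)` (`sphereUniform_forty_div_sqrt_le_norm_vecOp`). For a fixed pair `(x, y)` the form
`Re ⟨x, A y⟩` is odd and Lipschitz in `ψ`, hence concentrated around `0`. If the norm of `A` is
large then the form is large for all pairs in some ball of radius `1 / 4`, so integrating over pairs
loses only a ratio of volumes `5 ^ (2 n + 2 s)`, which the Gaussian tail absorbs.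

*Conclusion.* When the exceptional set has measure at most `1 / 4`, the sets where the gauge is at
most, or at least, its median still have measure at least `1 / 4` after its removal. On its
complement the gauge is Lipschitz with constant of order `1 / (r √n)`, so the two-set estimate
bounds the deviations (`sphereUniform_add_le_of_lipschitz_off`). Otherwise `exp (-s)` is bounded
below and the claim is trivial.
-/

namespace RandomState

open scoped Pointwise

/-! ### The multiplicative Brunn–Minkowski inequality -/

/-- One-dimensional Brunn–Minkowski inequality, in midpoint form. -/
theorem volume_add_volume_le_two_mul_of_midpoint {A B C : Set ℝ} (hA : MeasurableSet A)
    (hB : MeasurableSet B) (hA' : A.Nonempty) (hB' : B.Nonempty)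
    (h : ∀ x ∈ A, ∀ y ∈ B, (1 / 2 : ℝ) • (x + y) ∈ C) :
    volume A + volume B ≤ 2 * volume C := by
  have hC : 2 * volume C = volume ((2 : ℝ) • C) := by
    rw [Measure.addHaar_smul]
    simp
  -- Two compact sets `K` and `L` translated so that `max K = min L` overlap in a single point,
  -- and both translates lie in `2 • C`.
  have key : ∀ K L : Set ℝ, IsCompact K → IsCompact L → K ⊆ A → L ⊆ B → K.Nonempty →
      L.Nonempty → volume K + volume L ≤ 2 * volume C := by
    intro K L hK hL hKA hLB hK' hL'
    have hk := hK.sSup_mem hK'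
    have hl := hL.sInf_mem hL'
    set k := sSup K
    set l := sInf L
    rw [hC, ← measure_preimage_add_right volume (-l) K, ← measure_preimage_add_right volume (-k) L,
      ← measure_union₀]
    · apply measure_mono
      have mem : ∀ x ∈ A, ∀ y ∈ B, x + y ∈ (2 : ℝ) • C := fun x hx y hy =>
        ⟨_, h x hx y hy, by simp⟩
      rintro x (hx | hx)
      · simpa using mem _ (hKA hx) _ (hLB hl)
      · simpa using mem _ (hKA hk) _ (hLB hx)
    · exact (hL.measurableSet.preimage (measurable_add_const _)).nullMeasurableSet
    · refine measure_mono_null (t := {k + l}) ?_ (by simp)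
      rintro x ⟨h1, h2⟩
      have h3 : x + -l ≤ k := le_csSup hK.bddAbove h1
      have h4 : l ≤ x + -k := csInf_le hL.bddBelow h2
      simp only [Set.mem_singleton_iff]
      linarith
  obtain ⟨x₀, hx₀⟩ := hA'
  obtain ⟨y₀, hy₀⟩ := hB'
  rw [hA.measure_eq_iSup_isCompact, hB.measure_eq_iSup_isCompact]
  simp only [iSup_and']
  refine ENNReal.biSup_add_biSup_le' ⟨∅, by simp⟩ ⟨∅, by simp⟩ fun K hK L hL => ?_
  calc volume K + volume L ≤ volume (insert x₀ K) + volume (insert y₀ L) := by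
        gcongr <;> exact Set.subset_insert _ _
    _ ≤ _ := key _ _ (hK.2.insert _) (hL.2.insert _) (Set.insert_subset hx₀ hK.1)
        (Set.insert_subset hy₀ hL.1) (Set.insert_nonempty _ _) (Set.insert_nonempty _ _)

theorem mul_le_sq_of_add_le_two_mul {a b c : ℝ≥0∞} (h : a + b ≤ 2 * c) :
    a * b ≤ c ^ 2 := by
  rcases eq_or_ne c ⊤ with rfl | hc
  · simp
  have hab : a + b ≠ ⊤ := ne_top_of_le_ne_top (ENNReal.mul_ne_top (by simp) hc) h
  rw [ENNReal.add_ne_top] at hab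
  lift a to NNReal using hab.1
  lift b to NNReal using hab.2
  lift c to NNReal using hc
  norm_cast at h ⊢
  rw [← NNReal.coe_le_coe] at h ⊢
  push_cast at h ⊢
  nlinarith [sq_nonneg ((a : ℝ) - b), a.2, b.2, c.2]

/-- Layer cake formula for `[0, 1]`-valued functions with values in `ℝ≥0∞`. -/
theorem lintegral_eq_lintegral_Ioi_volume_lt {f : ℝ → ℝ≥0∞} (hf : Measurable f)
    (h1 : ∀ x, f x ≤ 1) :
    ∫⁻ x, f x = ∫⁻ t in Set.Ioi (0 : ℝ), volume {x | ENNReal.ofReal t < f x} := by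
  have hne : ∀ x, f x ≠ ⊤ := fun x => ne_top_of_le_ne_top ENNReal.one_ne_top (h1 x)
  have h := lintegral_eq_lintegral_meas_lt (volume : Measure ℝ) (f := fun x => (f x).toReal)
    (Filter.Eventually.of_forall fun x => ENNReal.toReal_nonneg) hf.ennreal_toReal.aemeasurable
  simp only [ENNReal.ofReal_toReal (hne _)] at h
  rw [h]
  refine setLIntegral_congr_fun measurableSet_Ioi fun t ht => ?_
  simp only [ENNReal.ofReal_lt_iff_lt_toReal (le_of_lt ht) (hne _)]

theorem lintegral_mul_lintegral_le_of_iSup_eq_one {f g h : ℝ → ℝ≥0∞} (hf : Measurable f)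
    (hg : Measurable g) (hh : Measurable h) (hf1 : ⨆ x, f x = 1) (hg1 : ⨆ x, g x = 1)
    (H : ∀ x y, f x * g y ≤ h ((1 / 2 : ℝ) • (x + y)) ^ 2) :
    (∫⁻ x, f x) * ∫⁻ x, g x ≤ (∫⁻ x, h x) ^ 2 := by
  apply mul_le_sq_of_add_le_two_mul
  have hfle : ∀ x, f x ≤ 1 := fun x => hf1 ▸ le_iSup f x
  have hgle : ∀ x, g x ≤ 1 := fun x => hg1 ▸ le_iSup g x
  have hmin : ∫⁻ x, min (h x) 1 ≤ ∫⁻ x, h x := lintegral_mono fun x => min_le_left _ _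
  refine le_trans ?_ (mul_le_mul_right hmin 2)
  rw [lintegral_eq_lintegral_Ioi_volume_lt hf hfle, lintegral_eq_lintegral_Ioi_volume_lt hg hgle,
    lintegral_eq_lintegral_Ioi_volume_lt (hh.min measurable_const) fun x => min_le_right _ _,
    ← lintegral_const_mul' _ _ (by simp), ← lintegral_add_left]
  · refine lintegral_mono fun t => ?_
    rcases lt_or_ge (ENNReal.ofReal t) 1 with ht | ht
    · apply volume_add_volume_le_two_mul_of_midpoint
      · exact measurableSet_lt measurable_const hf
      · exact measurableSet_lt measurable_const hg
      · exact lt_iSup_iff.1 (hf1 ▸ ht)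
      · exact lt_iSup_iff.1 (hg1 ▸ ht)
      · intro x hx y hy
        refine lt_min ?_ ht
        by_contra! hcon
        refine absurd (H x y) (not_le.2 ?_)
        calc h ((1 / 2 : ℝ) • (x + y)) ^ 2 ≤ ENNReal.ofReal t ^ 2 := by gcongr
          _ = ENNReal.ofReal t * ENNReal.ofReal t := sq _
          _ < f x * g y := ENNReal.mul_lt_mul hx hy
    · have e1 : {x | ENNReal.ofReal t < f x} = ∅ := by
        ext x; simpa using (hfle x).trans ht
      have e2 : {x | ENNReal.ofReal t < g x} = ∅ := by
        ext x; simpa using (hgle x).trans ht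
      simp [e1, e2]
  · apply Antitone.measurable
    intro a b hab
    exact measure_mono fun x (hx : _ < _) => (ENNReal.ofReal_le_ofReal hab).trans_lt hx

/-- Prékopa–Leindler inequality on the line, at the midpoint. -/
theorem lintegral_mul_lintegral_le_real {f g h : ℝ → ℝ≥0∞} (hf : Measurable f)
    (hg : Measurable g) (hh : Measurable h)
    (H : ∀ x y, f x * g y ≤ h ((1 / 2 : ℝ) • (x + y)) ^ 2) :
    (∫⁻ x, f x) * ∫⁻ x, g x ≤ (∫⁻ x, h x) ^ 2 := by
  -- Functions with finite suprema are rescaled to have supremum `1`.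
  have bdd : ∀ f g : ℝ → ℝ≥0∞, Measurable f → Measurable g → ⨆ x, f x ≠ ⊤ → ⨆ x, g x ≠ ⊤ →
      (∀ x y, f x * g y ≤ h ((1 / 2 : ℝ) • (x + y)) ^ 2) →
      (∫⁻ x, f x) * ∫⁻ x, g x ≤ (∫⁻ x, h x) ^ 2 := by
    intro f g hf hg ha hb H
    rcases eq_or_ne (⨆ x, f x) 0 with ha0 | ha0
    · simp only [ENNReal.iSup_eq_zero] at ha0
      simp [ha0]
    rcases eq_or_ne (⨆ x, g x) 0 with hb0 | hb0
    · simp only [ENNReal.iSup_eq_zero] at hb0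
      simp [hb0]
    set a := ⨆ x, f x with haf
    set b := ⨆ x, g x with hbg
    -- The geometric mean `u` is the matching scale for `h`.
    set u : ℝ≥0∞ := (a * b) ^ (1 / 2 : ℝ) with hu
    have hu2 : u ^ 2 = a * b := by
      rw [hu, ← ENNReal.rpow_natCast, ← ENNReal.rpow_mul]
      simp
    have hab0 : a * b ≠ 0 := mul_ne_zero ha0 hb0
    have hab : a * b ≠ ⊤ := ENNReal.mul_ne_top ha hb
    have hinv : a⁻¹ * b⁻¹ = u⁻¹ ^ 2 := by
      rw [← ENNReal.inv_pow, hu2, ENNReal.mul_inv (.inl ha0) (.inl ha)]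
    have key := lintegral_mul_lintegral_le_of_iSup_eq_one (f := fun x => a⁻¹ * f x)
      (g := fun x => b⁻¹ * g x) (h := fun x => u⁻¹ * h x) (hf.const_mul _) (hg.const_mul _)
      (hh.const_mul _) (by rw [← ENNReal.mul_iSup, ← haf, ENNReal.inv_mul_cancel ha0 ha])
      (by rw [← ENNReal.mul_iSup, ← hbg, ENNReal.inv_mul_cancel hb0 hb])
      (fun x y => by
        calc a⁻¹ * f x * (b⁻¹ * g y) = u⁻¹ ^ 2 * (f x * g y) := by rw [← hinv]; ring
          _ ≤ u⁻¹ ^ 2 * h ((1 / 2 : ℝ) • (x + y)) ^ 2 := by gcongr; exact H x y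
          _ = _ := by ring)
    rw [lintegral_const_mul _ hf, lintegral_const_mul _ hg, lintegral_const_mul _ hh, mul_pow,
      mul_mul_mul_comm, hinv] at key
    have hu0 : u⁻¹ ^ 2 ≠ 0 := by
      rw [← hinv]; simp [ha, hb]
    have hut : u⁻¹ ^ 2 ≠ ⊤ := by
      rw [← hinv]; exact ENNReal.mul_ne_top (by simpa) (by simpa)
    exact (ENNReal.mul_le_mul_iff_right hu0 hut).1 key
  -- The general case follows by truncation and monotone convergence.
  have trunc : ∀ f : ℝ → ℝ≥0∞, Measurable f →
      ∫⁻ x, f x = ⨆ k : ℕ, ∫⁻ x, min (f x) k := by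
    intro f hf
    rw [← lintegral_iSup (fun k => hf.min measurable_const)]
    · refine lintegral_congr fun x => ?_
      rw [← inf_iSup_eq, ENNReal.iSup_natCast, inf_top_eq]
    · intro i j hij x
      exact min_le_min_left _ (by exact_mod_cast hij)
  rw [trunc f hf, trunc g hg, ENNReal.iSup_mul]
  refine iSup_le fun i => ?_
  rw [ENNReal.mul_iSup]
  refine iSup_le fun j => ?_
  refine bdd _ _ (hf.min measurable_const) (hg.min measurable_const)
    (ne_top_of_le_ne_top (ENNReal.natCast_ne_top i) (iSup_le fun x => min_le_right _ _))
    (ne_top_of_le_ne_top (ENNReal.natCast_ne_top j) (iSup_le fun x => min_le_right _ _))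
    fun x y => (mul_le_mul' (min_le_left _ _) (min_le_left _ _)).trans (H x y)

/-- Prékopa–Leindler inequality on `ℝᵈ`, at the midpoint: integrating out all coordinates but one
reduces it to the line. -/
theorem lintegral_mul_lintegral_le_pi (d : ℕ) {f g h : (Fin d → ℝ) → ℝ≥0∞} (hf : Measurable f)
    (hg : Measurable g) (hh : Measurable h)
    (H : ∀ x y, f x * g y ≤ h ((1 / 2 : ℝ) • (x + y)) ^ 2) :
    (∫⁻ x, f x) * ∫⁻ x, g x ≤ (∫⁻ x, h x) ^ 2 := by
  induction d with
  | zero =>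
    simp only [lintegral_unique, volume_pi, Measure.pi_empty_univ, mul_one]
    simpa only [Subsingleton.elim _ (default : Fin 0 → ℝ)] using H default default
  | succ d ih =>
    have hmp := (volume_preserving_piFinSuccAbove (fun _ : Fin (d + 1) => ℝ) 0).symm
    set e := (MeasurableEquiv.piFinSuccAbove (fun _ : Fin (d + 1) => ℝ) 0).symm with he
    have split : ∀ f : (Fin (d + 1) → ℝ) → ℝ≥0∞, Measurable f →
        ∫⁻ x, f x = ∫⁻ x : ℝ, ∫⁻ y : Fin d → ℝ, f (e (x, y)) := by
      intro f hf
      rw [← hmp.lintegral_comp hf, Measure.volume_eq_prod]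
      exact lintegral_prod _ (hf.comp e.measurable).aemeasurable
    have meas : ∀ f : (Fin (d + 1) → ℝ) → ℝ≥0∞, Measurable f →
        Measurable fun x : ℝ => ∫⁻ y : Fin d → ℝ, f (e (x, y)) := fun f hf =>
      (hf.comp e.measurable).lintegral_prod_right'
    rw [split f hf, split g hg, split h hh]
    refine lintegral_mul_lintegral_le_real (meas f hf) (meas g hg) (meas h hh) fun x x' => ?_
    refine ih (hf.comp (e.measurable.comp measurable_prodMk_left))
      (hg.comp (e.measurable.comp measurable_prodMk_left))
      (hh.comp (e.measurable.comp measurable_prodMk_left)) fun y y' => ?_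
    have hmid : e ((1 / 2 : ℝ) • (x + x'), (1 / 2 : ℝ) • (y + y'))
        = (1 / 2 : ℝ) • (e (x, y) + e (x', y')) := by
      ext i
      refine Fin.cases ?_ (fun i => ?_) i <;>
        simp [he, MeasurableEquiv.piFinSuccAbove, Fin.insertNthEquiv, mul_add]
    simp only [hmid]
    exact H _ _

/-- Multiplicative Brunn–Minkowski inequality for a Haar measure on a finite-dimensional space. -/
theorem measure_mul_measure_le_of_midpoint {E : Type*} [NormedAddCommGroup E] [NormedSpace ℝ E]
    [FiniteDimensional ℝ E] [MeasurableSpace E] [BorelSpace E] (μ : Measure E)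
    [μ.IsAddHaarMeasure] {A B C : Set E} (hA : MeasurableSet A) (hB : MeasurableSet B)
    (hC : MeasurableSet C) (h : ∀ x ∈ A, ∀ y ∈ B, (1 / 2 : ℝ) • (x + y) ∈ C) :
    μ A * μ B ≤ μ C ^ 2 := by
  let e : E ≃L[ℝ] (Fin (Module.finrank ℝ E) → ℝ) :=
    ContinuousLinearEquiv.ofFinrankEq (by simp)
  have hemb : MeasurableEmbedding e := e.toHomeomorph.measurableEmbedding
  have : (μ.map e).IsAddHaarMeasure := e.isAddHaarMeasure_map μ
  obtain ⟨c, hc⟩ : ∃ c : ℝ≥0∞, ∀ S : Set E, μ S = c * volume (e.symm ⁻¹' S) := by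
    refine ⟨Measure.addHaarScalarFactor (μ.map e) volume, fun S => ?_⟩
    have h1 : μ S = μ.map e (e.symm ⁻¹' S) := by
      rw [hemb.map_apply, ← Set.preimage_comp]
      simp
    rw [h1]
    exact congrArg (fun ν : Measure _ => ν (e.symm ⁻¹' S))
      (Measure.isAddLeftInvariant_eq_smul (μ.map e) volume)
  have hm : ∀ {S : Set E}, MeasurableSet S → MeasurableSet (e.symm ⁻¹' S) := fun hS =>
    hS.preimage e.symm.continuous.measurable
  have key := lintegral_mul_lintegral_le_pi (Module.finrank ℝ E)
    (f := (e.symm ⁻¹' A).indicator 1) (g := (e.symm ⁻¹' B).indicator 1)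
    (h := (e.symm ⁻¹' C).indicator 1) (measurable_one.indicator (hm hA))
    (measurable_one.indicator (hm hB)) (measurable_one.indicator (hm hC)) (fun x y => by
      by_cases hx : e.symm x ∈ A
      · by_cases hy : e.symm y ∈ B
        · have := h _ hx _ hy
          rw [← map_add, ← map_smul] at this
          simp only [Set.indicator, Set.mem_preimage, hx, hy, this]
          simp
        · simp [Set.indicator, hy]
      · simp [Set.indicator, hx])
  rw [lintegral_indicator_one (hm hA), lintegral_indicator_one (hm hB),
    lintegral_indicator_one (hm hC)] at key
  rw [hc A, hc B, hc C, mul_mul_mul_comm, mul_pow, sq c]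
  gcongr
/-! ### Concentration of measure on the Euclidean sphere -/

section Concentration

variable {E : Type*} [NormedAddCommGroup E] [InnerProductSpace ℝ E]

theorem norm_midpoint_le {δ : ℝ} (hδ : 0 ≤ δ) {x y : E} (hx : ‖x‖ ≤ 1) (hy : ‖y‖ ≤ 1)
    (hxy : δ ≤ ‖x - y‖) : ‖(1 / 2 : ℝ) • (x + y)‖ ^ 2 ≤ 1 - δ ^ 2 / 4 := by
  have h := parallelogram_law_with_norm ℝ x y
  rw [norm_smul, Real.norm_of_nonneg (by norm_num)]
  nlinarith [mul_self_le_mul_self hδ hxy, norm_nonneg x, norm_nonneg y]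

theorem half_norm_sub_le_norm_smul_sub_smul {a b : E} (ha : ‖a‖ = 1) (hb : ‖b‖ = 1) {t u : ℝ}
    (ht : 1 / 2 ≤ t) (hu : 1 / 2 ≤ u) : ‖a - b‖ / 2 ≤ ‖t • a - u • b‖ := by
  refine le_of_sq_le_sq ?_ (norm_nonneg _)
  have h1 := norm_sub_sq_real a b
  have h2 := norm_sub_sq_real (t • a) (u • b)
  rw [norm_smul, norm_smul, ha, hb, inner_smul_left, inner_smul_right, Real.norm_eq_abs,
    Real.norm_eq_abs, mul_one, mul_one, sq_abs, sq_abs] at h2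
  simp only [conj_trivial] at h2
  rw [ha, hb] at h1
  have h3 : inner ℝ a b ≤ 1 := by
    have := real_inner_le_norm a b
    rwa [ha, hb, mul_one] at this
  rw [div_pow, h1, h2]
  nlinarith [sq_nonneg (t - u), mul_nonneg (sub_nonneg.2 h3)
    (show 0 ≤ t * u - 1 / 4 by nlinarith)]

variable [FiniteDimensional ℝ E] [MeasurableSpace E] [BorelSpace E] (μ : Measure E)
  [μ.IsAddHaarMeasure]

/-- Two distant subsets of the unit ball cannot both be large, since all midpoints between them
lie in a smaller concentric ball. -/
theorem measure_mul_measure_le_of_le_norm_sub {A B : Set E} (hA : MeasurableSet A)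
    (hB : MeasurableSet B) (hA1 : A ⊆ Metric.ball 0 1) (hB1 : B ⊆ Metric.ball 0 1) {δ : ℝ}
    (hδ : 0 ≤ δ) (h : ∀ x ∈ A, ∀ y ∈ B, δ ≤ ‖x - y‖) :
    μ A * μ B ≤ ENNReal.ofReal (Real.exp (-(Module.finrank ℝ E * δ ^ 2 / 4))) *
      μ (Metric.ball 0 1) ^ 2 := by
  rcases A.eq_empty_or_nonempty with rfl | ⟨x₀, hx₀⟩
  · simp
  rcases B.eq_empty_or_nonempty with rfl | ⟨y₀, hy₀⟩
  · simp
  have hmid : ∀ x ∈ A, ∀ y ∈ B, ‖(1 / 2 : ℝ) • (x + y)‖ ^ 2 ≤ 1 - δ ^ 2 / 4 := fun x hx y hy =>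
    norm_midpoint_le hδ (mem_ball_zero_iff.1 (hA1 hx)).le (mem_ball_zero_iff.1 (hB1 hy)).le
      (h x hx y hy)
  have hpos : 0 ≤ 1 - δ ^ 2 / 4 := (sq_nonneg _).trans (hmid x₀ hx₀ y₀ hy₀)
  have key := measure_mul_measure_le_of_midpoint μ hA hB
    (C := Metric.closedBall 0 √(1 - δ ^ 2 / 4)) Metric.isClosed_closedBall.measurableSet
    fun x hx y hy => mem_closedBall_zero_iff.2 (Real.le_sqrt_of_sq_le (hmid x hx y hy))
  refine key.trans ?_
  rw [μ.addHaar_closedBall _ (Real.sqrt_nonneg _), mul_pow, ← ENNReal.ofReal_pow (by positivity),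
    ← pow_mul, mul_comm _ 2, pow_mul, Real.sq_sqrt hpos]
  gcongr
  calc (1 - δ ^ 2 / 4) ^ Module.finrank ℝ E ≤ Real.exp (-(δ ^ 2 / 4)) ^ Module.finrank ℝ E := by
        gcongr
        linarith [Real.add_one_le_exp (-(δ ^ 2 / 4))]
    _ = _ := by
        rw [← Real.exp_nat_mul]
        congr 1
        ring

/-- Concentration on the sphere: two subsets at distance at least `δ` cannot both be large. The
estimate is transferred from the ball by thickening the two sets radially. -/
theorem toSphere_mul_toSphere_le (hd : Module.finrank ℝ E ≠ 0)
    {A B : Set (Metric.sphere (0 : E) 1)}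
    (hA : MeasurableSet A) (hB : MeasurableSet B) {δ : ℝ} (hδ : 0 ≤ δ)
    (h : ∀ x ∈ A, ∀ y ∈ B, δ ≤ ‖(x : E) - y‖) :
    μ.toSphere A * μ.toSphere B ≤
      4 * ENNReal.ofReal (Real.exp (-(Module.finrank ℝ E * δ ^ 2 / 16))) *
        μ.toSphere Set.univ ^ 2 := by
  let cone (S : Set (Metric.sphere (0 : E) 1)) : Set E := Set.Ioo (0 : ℝ) 1 • ((↑) '' S)
  have cone_meas : ∀ S, MeasurableSet S → MeasurableSet (cone S) := by
    intro S hS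
    have image_eq (r : Set.Ioi (0 : ℝ)) : Set.Ioo (0 : ℝ) r • (((↑) : _ → E) '' S) =
        (↑) '' (homeomorphUnitSphereProd E ⁻¹' S ×ˢ Set.Iio r) := by
      rw [← Set.image2_smul, Set.image2_image_right, ← Homeomorph.image_symm, Set.image_image,
        ← Set.image_subtype_val_Ioi_Iio, Set.image2_image_left, Set.image2_swap, ← Set.image_prod]
      rfl
    have : cone S = _ := image_eq ⟨1, Set.mem_Ioi.2 one_pos⟩
    rw [this]
    exact (MeasurableEmbedding.subtype_coe (measurableSet_singleton _).compl).measurableSet_image.2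
      ((homeomorphUnitSphereProd E).continuous.measurable (hS.prod measurableSet_Iio))
  have cone_ball : ∀ S, cone S ⊆ Metric.ball 0 1 := by
    rintro S _ ⟨t, ht, _, ⟨a, -, rfl⟩, rfl⟩
    simp [norm_smul, abs_of_pos ht.1, ht.2]
  -- The part of the cone at distance at least `1 / 2` from the origin carries half of its mass.
  let shell (S : Set (Metric.sphere (0 : E) 1)) : Set E := cone S \ ((1 / 2 : ℝ) • cone S)
  have shell_mem : ∀ S, ∀ x ∈ shell S, ∃ a ∈ S, ∃ t : ℝ, 1 / 2 ≤ t ∧ x = t • (a : E) := by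
    rintro S _ ⟨⟨t, ht, _, ⟨a, ha, rfl⟩, rfl⟩, hx⟩
    refine ⟨a, ha, t, ?_, rfl⟩
    by_contra! hlt
    refine hx ⟨(2 * t) • (a : E), ⟨2 * t, ⟨by linarith [ht.1], by linarith⟩, _, ⟨a, ha, rfl⟩, rfl⟩,
      ?_⟩
    simp [smul_smul]
  have shell_meas : ∀ S, MeasurableSet S → MeasurableSet (shell S) := fun S hS =>
    (cone_meas S hS).diff ((cone_meas S hS).const_smul₀ _)
  have shell_le : ∀ S, μ (cone S) ≤ 2 * μ (shell S) := by
    intro S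
    have hfin : μ (cone S) ≠ ⊤ :=
      ne_top_of_le_ne_top measure_ball_lt_top.ne (measure_mono (cone_ball S))
    have hhalf : μ ((1 / 2 : ℝ) • cone S) ≤ μ (cone S) / 2 := by
      rw [μ.addHaar_smul, ENNReal.div_eq_inv_mul]
      gcongr
      rw [abs_of_nonneg (by positivity), ← ENNReal.ofReal_ofNat, ← ENNReal.ofReal_inv_of_pos
        (by norm_num)]
      apply ENNReal.ofReal_le_ofReal
      calc (1 / 2 : ℝ) ^ Module.finrank ℝ E ≤ (1 / 2) ^ 1 :=
            pow_le_pow_of_le_one (by norm_num) (by norm_num) (Nat.one_le_iff_ne_zero.2 hd)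
        _ = 2⁻¹ := by norm_num
    have h1 : μ (cone S) / 2 + μ (cone S) / 2 ≤ μ (shell S) + μ (cone S) / 2 := by
      rw [ENNReal.add_halves]
      calc μ (cone S) ≤ μ (shell S ∪ (1 / 2 : ℝ) • cone S) :=
            measure_mono fun x hx => by
              by_cases hx' : x ∈ (1 / 2 : ℝ) • cone S
              · exact .inr hx'
              · exact .inl ⟨hx, hx'⟩
        _ ≤ _ := (measure_union_le _ _).trans (by gcongr)
    have h2 := (ENNReal.add_le_add_iff_right (ENNReal.div_ne_top hfin (by simp))).1 h1
    rwa [ENNReal.div_le_iff_le_mul (by simp) (by simp), mul_comm] at h2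
  have key := measure_mul_measure_le_of_le_norm_sub μ (shell_meas A hA) (shell_meas B hB)
    (Set.sdiff_subset.trans (cone_ball A)) (Set.sdiff_subset.trans (cone_ball B))
    (δ := δ / 2) (by positivity) (by
      intro x hx y hy
      obtain ⟨a, ha, t, ht, rfl⟩ := shell_mem A x hx
      obtain ⟨b, hb, u, hu, rfl⟩ := shell_mem B y hy
      have := half_norm_sub_le_norm_smul_sub_smul (a := (a : E)) (b := (b : E)) (by simp)
        (by simp) ht hu
      linarith [h a ha b hb])
  rw [μ.toSphere_apply' hA, μ.toSphere_apply' hB, μ.toSphere_apply_univ]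
  set D : ℝ≥0∞ := (Module.finrank ℝ E : ℝ≥0∞)
  calc D * μ (cone A) * (D * μ (cone B)) ≤ D * (2 * μ (shell A)) * (D * (2 * μ (shell B))) := by
        gcongr
        exacts [shell_le A, shell_le B]
    _ = 4 * D ^ 2 * (μ (shell A) * μ (shell B)) := by ring
    _ ≤ 4 * D ^ 2 * (ENNReal.ofReal (Real.exp (-(Module.finrank ℝ E * (δ / 2) ^ 2 / 4))) *
        μ (Metric.ball 0 1) ^ 2) := by gcongr
    _ = _ := by
        rw [show -((Module.finrank ℝ E : ℝ) * (δ / 2) ^ 2 / 4)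
          = -(Module.finrank ℝ E * δ ^ 2 / 16) by ring]
        ring

end Concentration

theorem finrank_bipartite (n s : ℕ) : Module.finrank ℝ (Bipartite n s) = 2 * (n * s) := by
  rw [← Module.finrank_mul_finrank ℝ ℂ (Bipartite n s)]
  simp

theorem sphereUniform_univ_le_one (n s : ℕ) : sphereUniform n s Set.univ ≤ 1 := by
  rw [sphereUniform, Measure.smul_apply, smul_eq_mul]
  exact ENNReal.inv_mul_le_one _

instance (n s : ℕ) : IsFiniteMeasure (sphereUniform n s) :=
  ⟨(sphereUniform_univ_le_one n s).trans_lt ENNReal.one_lt_top⟩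

theorem sphereUniform_univ {n s : ℕ} (hn : n ≠ 0) (hs : s ≠ 0) :
    sphereUniform n s Set.univ = 1 := by
  rw [sphereUniform, Measure.smul_apply, smul_eq_mul]
  have : Nontrivial (Bipartite n s) :=
    Module.nontrivial_of_finrank_pos (R := ℝ) (by rw [finrank_bipartite]; positivity)
  refine ENNReal.inv_mul_cancel ?_ (measure_ne_top _ _)
  rw [ne_eq, Measure.measure_univ_eq_zero]
  exact Measure.toSphere_ne_zero _

theorem sphereUniform_mul_sphereUniform_le {n s : ℕ} (hn : n ≠ 0) (hs : s ≠ 0)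
    {A B : Set (Metric.sphere (0 : Bipartite n s) 1)}
    (hA : MeasurableSet A) (hB : MeasurableSet B) {δ : ℝ} (hδ : 0 ≤ δ)
    (h : ∀ x ∈ A, ∀ y ∈ B, δ ≤ ‖(x : Bipartite n s) - y‖) :
    sphereUniform n s A * sphereUniform n s B ≤
      4 * ENNReal.ofReal (Real.exp (-(n * s * δ ^ 2 / 8))) := by
  have key := toSphere_mul_toSphere_le (volume : Measure (Bipartite n s))
    (by rw [finrank_bipartite]; positivity) hA hB hδ h
  rw [finrank_bipartite] at key
  simp only [sphereUniform, Measure.smul_apply, smul_eq_mul]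
  set u := (volume : Measure (Bipartite n s)).toSphere Set.univ
  calc _ = u⁻¹ ^ 2 * ((volume : Measure (Bipartite n s)).toSphere A *
        (volume : Measure (Bipartite n s)).toSphere B) := by ring
    _ ≤ u⁻¹ ^ 2 * (4 * ENNReal.ofReal (Real.exp (-((2 * (n * s) : ℕ) * δ ^ 2 / 16))) * u ^ 2) := by
        gcongr
    _ = (u⁻¹ * u) ^ 2 * (4 * ENNReal.ofReal (Real.exp (-(n * s * δ ^ 2 / 8)))) := by
        rw [show -(((2 * (n * s) : ℕ) : ℝ) * δ ^ 2 / 16) = -(n * s * δ ^ 2 / 8) by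
          push_cast; ring]
        ring
    _ ≤ 1 ^ 2 * (4 * ENNReal.ofReal (Real.exp (-(n * s * δ ^ 2 / 8)))) := by
        gcongr
        exact ENNReal.inv_mul_le_one _
    _ = _ := by ring

/-! ### The operator norm of a random bipartite vector -/

/-- The coefficient matrix of a vector of `ℂⁿ ⊗ ℂˢ`. -/
def coeffMatrix {n s : ℕ} (ψ : Bipartite n s) : Matrix (Fin n) (Fin s) ℂ :=
  Matrix.of fun i k => ψ (i, k)

/-- The operator `ℂˢ → ℂⁿ` with matrix `coeffMatrix ψ`, for the Euclidean norms. -/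
noncomputable def vecOp (n s : ℕ) :
    Bipartite n s →ₗ[ℂ] EuclideanSpace ℂ (Fin s) →L[ℂ] EuclideanSpace ℂ (Fin n) :=
  (LinearMap.toContinuousLinearMap.toLinearMap ∘ₗ
    (Matrix.toLpLin 2 2 : Matrix (Fin n) (Fin s) ℂ ≃ₗ[ℂ] _).toLinearMap) ∘ₗ
    { toFun := coeffMatrix
      map_add' := fun _ _ => rfl
      map_smul' := fun _ _ => rfl }

theorem vecOp_apply {n s : ℕ} (ψ : Bipartite n s) (y : EuclideanSpace ℂ (Fin s)) (i : Fin n) :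
    vecOp n s ψ y i = ∑ k, ψ (i, k) * y k := by
  simp [vecOp, Matrix.mulVec, dotProduct]
  rfl

theorem norm_vecOp_apply_le {n s : ℕ} (ψ : Bipartite n s) (y : EuclideanSpace ℂ (Fin s)) :
    ‖vecOp n s ψ y‖ ≤ ‖ψ‖ * ‖y‖ := by
  refine le_of_sq_le_sq ?_ (by positivity)
  rw [mul_pow, EuclideanSpace.norm_sq_eq, EuclideanSpace.norm_sq_eq ψ, Fintype.sum_prod_type,
    Finset.sum_mul]
  refine Finset.sum_le_sum fun i _ => ?_
  rw [vecOp_apply, EuclideanSpace.norm_sq_eq]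
  calc ‖∑ k, ψ (i, k) * y k‖ ^ 2 ≤ (∑ k, ‖ψ (i, k)‖ * ‖y k‖) ^ 2 := by
        gcongr
        exact (norm_sum_le _ _).trans_eq (by simp)
    _ ≤ _ := Finset.sum_mul_sq_le_sq_mul_sq _ _ _

theorem continuous_vecOp (n s : ℕ) : Continuous (vecOp n s) :=
  LinearMap.continuous_of_finiteDimensional _

theorem sphereUniform_neg {n s : ℕ} {S : Set (Metric.sphere (0 : Bipartite n s) 1)}
    (hS : MeasurableSet S) :
    sphereUniform n s ((fun ψ => -ψ) ⁻¹' S) = sphereUniform n s S := by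
  have hS' : MeasurableSet ((fun ψ => -ψ) ⁻¹' S) := hS.preimage continuous_neg.measurable
  simp only [sphereUniform, Measure.smul_apply]
  rw [Measure.toSphere_apply' _ hS, Measure.toSphere_apply' _ hS']
  have : Set.Ioo (0 : ℝ) 1 • ((↑) '' ((fun ψ => -ψ) ⁻¹' S) : Set (Bipartite n s)) =
      (-1 : ℝ) • (Set.Ioo (0 : ℝ) 1 • ((↑) '' S : Set (Bipartite n s))) := by
    ext x
    constructor
    · rintro ⟨t, ht, _, ⟨a, ha, rfl⟩, rfl⟩
      exact ⟨_, ⟨t, ht, _, ⟨_, ha, rfl⟩, rfl⟩, by simp⟩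
    · rintro ⟨_, ⟨t, ht, _, ⟨a, ha, rfl⟩, rfl⟩, rfl⟩
      exact ⟨t, ht, _, ⟨-a, by simpa using ha, rfl⟩, by simp⟩
  rw [this, Measure.addHaar_smul]
  simp

/-- Tail bound for an odd Lipschitz function on the sphere; `0` is a median by symmetry. -/
theorem sphereUniform_le_of_odd {n s : ℕ} (hn : n ≠ 0) (hs : s ≠ 0)
    {f : Metric.sphere (0 : Bipartite n s) 1 → ℝ} (hf : Measurable f) (hodd : ∀ ψ, f (-ψ) = -f ψ)
    {R : ℝ} (hR : 0 < R)
    (hlip : ∀ ψ φ : Metric.sphere (0 : Bipartite n s) 1,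
      f ψ - f φ ≤ R * ‖(φ : Bipartite n s) - ψ‖) {θ : ℝ} (hθ : 0 ≤ θ) :
    sphereUniform n s {ψ | θ ≤ f ψ} ≤
      8 * ENNReal.ofReal (Real.exp (-(n * s * (θ / R) ^ 2 / 8))) := by
  have hA : MeasurableSet {ψ | f ψ ≤ 0} := measurableSet_le hf measurable_const
  have hhalf : 1 ≤ 2 * sphereUniform n s {ψ | f ψ ≤ 0} := by
    rw [← sphereUniform_univ hn hs, two_mul]
    nth_rewrite 2 [← sphereUniform_neg hA]
    refine le_trans (measure_mono fun ψ _ => ?_) (measure_union_le _ _)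
    rcases le_total (f ψ) 0 with h | h
    · exact .inl h
    · exact .inr (by simpa [hodd] using h)
  have key := sphereUniform_mul_sphereUniform_le hn hs hA
    (B := {ψ | θ ≤ f ψ}) (measurableSet_le measurable_const hf) (δ := θ / R) (by positivity) (by
      intro φ hφ ψ hψ
      rw [div_le_iff₀' hR]
      have h1 : f φ ≤ 0 := hφ
      have h2 : θ ≤ f ψ := hψ
      linarith [hlip ψ φ])
  calc sphereUniform n s {ψ | θ ≤ f ψ} ≤ (2 * sphereUniform n s {ψ | f ψ ≤ 0}) *
        sphereUniform n s {ψ | θ ≤ f ψ} := le_mul_of_one_le_left zero_le hhalf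
    _ ≤ 2 * (4 * ENNReal.ofReal (Real.exp (-(n * s * (θ / R) ^ 2 / 8)))) := by
        rw [mul_assoc]
        gcongr
    _ = _ := by ring

/-- Pairs `(x, y)` with `x ∈ ℂⁿ` and `y ∈ ℂˢ`, with the maximum of the two Euclidean norms. -/
abbrev VecPair (n s : ℕ) : Type := EuclideanSpace ℂ (Fin n) × EuclideanSpace ℂ (Fin s)

/-- The bilinear form of `vecOp ψ` is large near some pair of vectors of the unit ball. -/
theorem exists_forall_ball_le_re_inner {n s : ℕ} {T : ℝ} (hT : 0 < T) {ψ : Bipartite n s}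
    (hψ : T ≤ ‖vecOp n s ψ‖) :
    ∃ z₀ : VecPair n s, ‖z₀‖ ≤ 1 ∧
      ∀ z ∈ Metric.ball z₀ (1 / 4), 3 / 8 * T ≤ (inner ℂ z.1 (vecOp n s ψ z.2)).re := by
  set A := vecOp n s ψ
  have hA : 0 < ‖A‖ := hT.trans_le hψ
  obtain ⟨y, hy, hAy⟩ := ContinuousLinearMap.exists_lt_apply_of_lt_opNorm A
    (show 15 / 16 * ‖A‖ < ‖A‖ by linarith)
  have hAy0 : 0 < ‖A y‖ := by linarith
  set x : EuclideanSpace ℂ (Fin n) := ((‖A y‖⁻¹ : ℝ) : ℂ) • A y with hx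
  have hx1 : ‖x‖ = 1 := by
    rw [hx, norm_smul, Complex.norm_real, Real.norm_of_nonneg (by positivity)]
    field_simp
  have hxy : (inner ℂ x (A y)).re = ‖A y‖ := by
    have hinner : (inner ℂ (A y) (A y)).re = ‖A y‖ ^ 2 := inner_self_eq_norm_sq (𝕜 := ℂ) (A y)
    rw [hx, inner_smul_left, Complex.conj_ofReal, Complex.re_ofReal_mul, hinner]
    field_simp
  refine ⟨(x, y), by simp [Prod.norm_def, hx1, hy.le], ?_⟩
  rintro ⟨x', y'⟩ hz
  rw [mem_ball_iff_norm, Prod.norm_def, max_lt_iff] at hz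
  obtain ⟨h1, h2⟩ := hz
  simp only [Prod.mk_sub_mk] at h1 h2 ⊢
  have split : inner ℂ x' (A y') = inner ℂ x (A y) + inner ℂ (x' - x) (A y)
      + inner ℂ x' (A (y' - y)) := by
    rw [map_sub, inner_sub_left, inner_sub_right]
    ring
  have b1 : -(‖A‖ / 4) ≤ (inner ℂ (x' - x) (A y)).re := by
    refine (abs_le.1 ((Complex.abs_re_le_norm _).trans ((norm_inner_le_norm _ _).trans ?_))).1
    have : ‖A y‖ ≤ ‖A‖ := A.unit_le_opNorm y hy.le
    nlinarith [norm_nonneg (x' - x)]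
  have b2 : -(5 / 16 * ‖A‖) ≤ (inner ℂ x' (A (y' - y))).re := by
    refine (abs_le.1 ((Complex.abs_re_le_norm _).trans ((norm_inner_le_norm _ _).trans ?_))).1
    have h3 : ‖A (y' - y)‖ ≤ ‖A‖ * (1 / 4) := A.le_opNorm_of_le h2.le
    have h4 : ‖x'‖ ≤ 5 / 4 := by
      have := norm_add_le x (x' - x)
      rw [add_sub_cancel, hx1] at this
      linarith
    calc ‖x'‖ * ‖A (y' - y)‖ ≤ 5 / 4 * (‖A‖ * (1 / 4)) := by gcongr
      _ = _ := by ring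
  rw [split, Complex.add_re, Complex.add_re, hxy]
  linarith

/-- Volumetric substitute for a union bound over nets: averaging the bilinear form over pairs of
vectors compares the operator norm with the form at a single pair. -/
theorem sphereUniform_le_norm_vecOp {n s : ℕ} (hn : n ≠ 0) (hs : s ≠ 0) {T : ℝ} (hT : 0 < T) :
    sphereUniform n s {ψ | T ≤ ‖vecOp n s ψ‖} ≤
      5 ^ (2 * n + 2 * s) *
        (8 * ENNReal.ofReal (Real.exp (-(n * s * (6 / 25 * T) ^ 2 / 8)))) := by
  have hdim : Module.finrank ℝ (VecPair n s) = 2 * n + 2 * s := by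
    rw [Module.finrank_prod, ← Module.finrank_mul_finrank ℝ ℂ (EuclideanSpace ℂ (Fin n)),
      ← Module.finrank_mul_finrank ℝ ℂ (EuclideanSpace ℂ (Fin s))]
    simp
  let ν : Measure (VecPair n s) := volume.prod volume
  have : ν.IsAddHaarMeasure := Measure.prod.instIsAddHaarMeasure volume volume
  set p := 8 * ENNReal.ofReal (Real.exp (-(n * s * (6 / 25 * T) ^ 2 / 8)))
  let F : Metric.sphere (0 : Bipartite n s) 1 × VecPair n s → ℝ := fun q =>
    (inner ℂ q.2.1 (vecOp n s q.1 q.2.2)).re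
  have hF : Continuous F := by
    have h1 : Continuous fun q : Metric.sphere (0 : Bipartite n s) 1 × VecPair n s =>
        vecOp n s q.1 := (continuous_vecOp n s).comp (by fun_prop)
    exact Complex.continuous_re.comp (Continuous.inner (by fun_prop) (h1.clm_apply (by fun_prop)))
  let G : Set (Metric.sphere (0 : Bipartite n s) 1 × VecPair n s) :=
    {q | q.2 ∈ Metric.ball (0 : VecPair n s) (5 / 4) ∧ 3 / 8 * T ≤ F q}
  have hG : MeasurableSet G :=
    (Metric.isOpen_ball.measurableSet.preimage measurable_snd).inter
      (isClosed_le continuous_const hF).measurableSet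
  have hbad : MeasurableSet {ψ : Metric.sphere (0 : Bipartite n s) 1 | T ≤ ‖vecOp n s ψ‖} :=
    (isClosed_le continuous_const
      ((continuous_vecOp n s).comp continuous_subtype_val).norm).measurableSet
  -- The set `G` is sliced in both ways: each `ψ` of large norm contributes at least a ball of
  -- pairs, and for each pair the contributing `ψ` form a tail event.
  have lower : ν (Metric.ball 0 (1 / 4)) * sphereUniform n s {ψ | T ≤ ‖vecOp n s ψ‖} ≤
      (sphereUniform n s).prod ν G := by
    rw [Measure.prod_apply hG, ← setLIntegral_const]
    refine (setLIntegral_mono' hbad fun ψ hψ => ?_).trans (setLIntegral_le_lintegral _ _)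
    obtain ⟨z₀, hz₀, hz⟩ := exists_forall_ball_le_re_inner hT hψ
    rw [← Measure.addHaar_ball_center ν z₀]
    refine measure_mono fun z hzb => ⟨?_, hz z hzb⟩
    rw [mem_ball_zero_iff]
    have h1 := norm_add_le z₀ (z - z₀)
    rw [add_sub_cancel] at h1
    rw [mem_ball_iff_norm] at hzb
    linarith
  have upper : (sphereUniform n s).prod ν G ≤ p * ν (Metric.ball 0 (5 / 4)) := by
    rw [Measure.prod_apply_symm hG, ← setLIntegral_const,
      ← lintegral_indicator Metric.isOpen_ball.measurableSet]
    refine lintegral_mono fun z => ?_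
    by_cases hz : z ∈ Metric.ball (0 : VecPair n s) (5 / 4)
    · rw [Set.indicator_of_mem hz]
      have hz' := mem_ball_zero_iff.1 hz
      rw [Prod.norm_def, max_lt_iff] at hz'
      have := sphereUniform_le_of_odd hn hs (f := fun ψ => F (ψ, z))
        (hF.measurable.comp measurable_prodMk_right) (fun ψ => by simp [F]) (R := 25 / 16)
        (by norm_num) (fun ψ φ => by
          simp only [F]
          rw [← Complex.sub_re, ← inner_sub_right, ← sub_apply, ← map_sub,
            norm_sub_rev]
          refine (Complex.re_le_norm _).trans ((norm_inner_le_norm _ _).trans ?_)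
          have h1 := norm_vecOp_apply_le ((ψ : Bipartite n s) - (φ : Bipartite n s)) z.2
          calc ‖z.1‖ * ‖vecOp n s ((ψ : Bipartite n s) - (φ : Bipartite n s)) z.2‖ ≤
              5 / 4 * (‖(ψ : Bipartite n s) - (φ : Bipartite n s)‖ * (5 / 4)) := by
                gcongr
                · exact hz'.1.le
                · exact h1.trans (by gcongr; exact hz'.2.le)
            _ = _ := by ring) (θ := 3 / 8 * T) (by positivity)
      rw [show 3 / 8 * T / (25 / 16) = 6 / 25 * T by ring] at this
      exact (measure_mono fun ψ hψ => hψ.2).trans this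
    · rw [Set.indicator_of_notMem hz, nonpos_iff_eq_zero]
      convert measure_empty (μ := sphereUniform n s)
      ext ψ
      simpa [G] using fun h => absurd (mem_ball_zero_iff.2 h) hz
  have h := lower.trans upper
  have h0 : ν (Metric.ball 0 (1 / 4)) ≠ 0 := (Metric.measure_ball_pos ν _ (by norm_num)).ne'
  have h1 : ν (Metric.ball 0 (1 / 4)) ≠ ⊤ := measure_ball_lt_top.ne
  have h5 : ν (Metric.ball 0 (5 / 4)) = 5 ^ (2 * n + 2 * s) * ν (Metric.ball 0 (1 / 4)) := by
    rw [show (5 / 4 : ℝ) = 5 * (1 / 4) by norm_num,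
      Measure.addHaar_ball_mul_of_pos ν 0 (show (0 : ℝ) < 5 by norm_num), hdim,
      ENNReal.ofReal_pow (by norm_num)]
    simp
  rw [h5, mul_left_comm, ← mul_assoc, mul_comm (ν _)] at h
  exact (ENNReal.mul_le_mul_iff_left h0 h1).1 h

/-- With probability at least `1 - 8 exp (-s)`, the operator norm of a random unit vector of
`ℂⁿ ⊗ ℂˢ` is of order `1 / √n`. -/
theorem sphereUniform_forty_div_sqrt_le_norm_vecOp {n s : ℕ} (hn : n ≠ 0) (hns : n ≤ s) :
    sphereUniform n s {ψ | 40 / √n ≤ ‖vecOp n s ψ‖} ≤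
      8 * ENNReal.ofReal (Real.exp (-s)) := by
  have hn' : (0 : ℝ) < n := by positivity
  refine (sphereUniform_le_norm_vecOp hn (by omega) (T := 40 / √n) (by positivity)).trans ?_
  -- At `T = 40 / √n` the Gaussian tail is below `exp (-11 s)`, and the volume ratio
  -- `5 ^ (2 n + 2 s)` is at most `exp (10 s)`.
  have h1 : (5 : ℝ≥0∞) ^ (2 * n + 2 * s) ≤ ENNReal.ofReal (Real.exp (10 * s)) := by
    have h2 : (5 : ℝ) ^ (2 * n + 2 * s) ≤ Real.exp (10 * s) := by
      calc (5 : ℝ) ^ (2 * n + 2 * s) ≤ 5 ^ (4 * s) :=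
            pow_le_pow_right₀ (by norm_num) (by omega)
        _ = (5 ^ 4) ^ s := pow_mul _ _ _
        _ ≤ (Real.exp 1 ^ 10) ^ s := by
            have := Real.add_one_le_exp 1
            gcongr
            calc (5 : ℝ) ^ 4 ≤ (1 + 1) ^ 10 := by norm_num
              _ ≤ _ := by gcongr
        _ = _ := by
            rw [← pow_mul, ← Real.exp_nat_mul]
            push_cast
            ring_nf
    calc (5 : ℝ≥0∞) ^ (2 * n + 2 * s) = ENNReal.ofReal (5 ^ (2 * n + 2 * s)) := by
          rw [ENNReal.ofReal_pow (by norm_num)]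
          simp
      _ ≤ _ := ENNReal.ofReal_le_ofReal h2
  calc _ ≤ ENNReal.ofReal (Real.exp (10 * s)) * (8 * ENNReal.ofReal (Real.exp (-(11 * s)))) := by
        gcongr
        rw [mul_pow (6 / 25), div_pow 40, Real.sq_sqrt hn'.le]
        field_simp
        nlinarith [Nat.cast_nonneg (α := ℝ) s]
    _ = _ := by
        rw [mul_left_comm, ← ENNReal.ofReal_mul (by positivity), ← Real.exp_add]
        ring_nf

/-! ### The Hilbert–Schmidt norm and the reduced state -/

theorem hsNorm_sq {n : ℕ} (A : Mat n) : hsNorm A ^ 2 = ∑ i, ∑ j, ‖A i j‖ ^ 2 := by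
  have h : (Matrix.trace (A * Aᴴ)).re = ∑ i, ∑ j, ‖A i j‖ ^ 2 := by
    simp only [Matrix.trace, Matrix.diag, Matrix.mul_apply, Matrix.conjTranspose_apply,
      Complex.re_sum]
    refine Finset.sum_congr rfl fun i _ => Finset.sum_congr rfl fun j _ => ?_
    rw [Complex.star_def, Complex.mul_conj, Complex.ofReal_re, Complex.normSq_eq_norm_sq]
  rw [hsNorm, h, Real.sq_sqrt (by positivity)]

theorem hsNorm_nonneg {n : ℕ} (A : Mat n) : 0 ≤ hsNorm A := Real.sqrt_nonneg _

theorem hsNorm_eq_norm {n : ℕ} (A : Mat n) :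
    hsNorm A = ‖(WithLp.toLp 2 fun p : Fin n × Fin n => A p.1 p.2 : Bipartite n n)‖ := by
  rw [← sq_eq_sq₀ (hsNorm_nonneg _) (norm_nonneg _), hsNorm_sq, EuclideanSpace.norm_sq_eq,
    Fintype.sum_prod_type]

theorem hsNorm_add_le {n : ℕ} (A B : Mat n) : hsNorm (A + B) ≤ hsNorm A + hsNorm B := by
  simp only [hsNorm_eq_norm]
  exact norm_add_le (WithLp.toLp 2 fun p : Fin n × Fin n => A p.1 p.2 : Bipartite n n)
    (WithLp.toLp 2 fun p => B p.1 p.2)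

theorem hsNorm_real_smul {n : ℕ} (t : ℝ) (A : Mat n) : hsNorm (t • A) = |t| * hsNorm A := by
  simp only [hsNorm_eq_norm]
  exact norm_smul t (WithLp.toLp 2 fun p : Fin n × Fin n => A p.1 p.2 : Bipartite n n)

theorem hsNorm_conjTranspose {n : ℕ} (A : Mat n) : hsNorm Aᴴ = hsNorm A := by
  rw [← sq_eq_sq₀ (hsNorm_nonneg _) (hsNorm_nonneg _), hsNorm_sq, hsNorm_sq, Finset.sum_comm]
  simp

theorem hsNorm_zero {n : ℕ} : hsNorm (0 : Mat n) = 0 := by simp [hsNorm]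

theorem continuous_hsNorm {n : ℕ} : Continuous (hsNorm : Mat n → ℝ) := by
  unfold hsNorm
  fun_prop

theorem partialTrace_pureState {n s : ℕ} (ψ : Bipartite n s) :
    partialTrace (pureState ψ) = coeffMatrix ψ * (coeffMatrix ψ)ᴴ := by
  ext i j
  simp [partialTrace, pureState, coeffMatrix, Matrix.mul_apply]

theorem coeffMatrix_sub {n s : ℕ} (ψ φ : Bipartite n s) :
    coeffMatrix (ψ - φ) = coeffMatrix ψ - coeffMatrix φ := rfl

theorem hsNorm_coeffMatrix_mul_le {n s : ℕ} (ψ φ : Bipartite n s) :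
    hsNorm (coeffMatrix ψ * (coeffMatrix φ)ᴴ) ≤ ‖vecOp n s ψ‖ * ‖φ‖ := by
  refine le_of_sq_le_sq ?_ (by positivity)
  rw [hsNorm_sq, Finset.sum_comm, mul_pow, EuclideanSpace.norm_sq_eq φ, Fintype.sum_prod_type,
    Finset.mul_sum]
  refine Finset.sum_le_sum fun j _ => ?_
  have h := (vecOp n s ψ).le_opNorm (WithLp.toLp 2 fun k => star (φ (j, k)))
  have h2 := pow_le_pow_left₀ (norm_nonneg _) h 2
  rw [mul_pow, EuclideanSpace.norm_sq_eq, EuclideanSpace.norm_sq_eq] at h2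
  simpa [vecOp_apply, Matrix.mul_apply, coeffMatrix] using h2

/-- On vectors whose associated operators have norm at most `L`, the reduced state is a
`2 L`-Lipschitz function of the vector. -/
theorem hsNorm_partialTrace_sub_le {n s : ℕ} {L : ℝ} {ψ φ : Bipartite n s}
    (hψ : ‖vecOp n s ψ‖ ≤ L) (hφ : ‖vecOp n s φ‖ ≤ L) :
    hsNorm (partialTrace (pureState ψ) - partialTrace (pureState φ)) ≤ 2 * L * ‖ψ - φ‖ := by
  have split : partialTrace (pureState ψ) - partialTrace (pureState φ) =
      coeffMatrix ψ * (coeffMatrix (ψ - φ))ᴴ + (coeffMatrix φ * (coeffMatrix (ψ - φ))ᴴ)ᴴ := by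
    rw [partialTrace_pureState, partialTrace_pureState, coeffMatrix_sub,
      Matrix.conjTranspose_mul, Matrix.conjTranspose_conjTranspose, Matrix.conjTranspose_sub,
      Matrix.mul_sub, Matrix.sub_mul]
    abel
  rw [split]
  refine (hsNorm_add_le _ _).trans ?_
  rw [hsNorm_conjTranspose]
  have h1 := hsNorm_coeffMatrix_mul_le ψ (ψ - φ)
  have h2 := hsNorm_coeffMatrix_mul_le φ (ψ - φ)
  have h3 := mul_le_mul_of_nonneg_right hψ (norm_nonneg (ψ - φ))
  have h4 := mul_le_mul_of_nonneg_right hφ (norm_nonneg (ψ - φ))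
  linarith

theorem continuous_partialTrace_pureState (n s : ℕ) :
    Continuous fun ψ : Bipartite n s => partialTrace (pureState ψ) := by
  refine continuous_matrix fun i j => ?_
  simp only [partialTrace, pureState, Matrix.of_apply]
  fun_prop

theorem partialTrace_pureState_mem {n s : ℕ} {ψ : Bipartite n s} (hψ : ‖ψ‖ = 1) :
    partialTrace (pureState ψ) ∈ saTraceOne n := by
  refine ⟨by rw [partialTrace_pureState]; exact Matrix.isHermitian_mul_conjTranspose_self _, ?_⟩
  have h : ((‖ψ‖ ^ 2 : ℝ) : ℂ) = 1 := by simp [hψ]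
  rw [← h, EuclideanSpace.norm_sq_eq, Fintype.sum_prod_type]
  simp [Matrix.trace, partialTrace, pureState, Complex.mul_conj, Complex.normSq_eq_norm_sq]

theorem isClosed_saTraceOne (n : ℕ) : IsClosed (saTraceOne n) :=
  (isClosed_eq (f := fun A : Mat n => Aᴴ) (by fun_prop) continuous_id).inter
    (isClosed_eq (f := fun A : Mat n => A.trace) (by fun_prop) continuous_const)

instance (n : ℕ) : BorelSpace (Mat n) := inferInstanceAs (BorelSpace (Fin n → Fin n → ℂ))

/-! ### The gauge of a state body -/

theorem maxMixed_mem {n : ℕ} (hn : n ≠ 0) : maxMixed n ∈ saTraceOne n := by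
  refine ⟨?_, by simp [maxMixed, hn]⟩
  simp [maxMixed, Matrix.IsHermitian, Matrix.conjTranspose_smul]

section Gauge

variable {n : ℕ} {K : Set (Mat n)} {r : ℝ}

/-- Traceless Hermitian matrices of Hilbert–Schmidt norm at most `r t` lie in `t K₀`. -/
theorem mem_smul_recenter (hn : n ≠ 0) (hr : 0 < r) (hK : hsBall (maxMixed n) r ⊆ K) {X : Mat n}
    (hX : X.IsHermitian) (hX0 : X.trace = 0) {t : ℝ} (ht : 0 < t) (hXt : hsNorm X / r ≤ t) :
    X ∈ t • recenter K := by
  refine ⟨t⁻¹ • X, ⟨maxMixed n + t⁻¹ • X, hK ⟨⟨?_, ?_⟩, ?_⟩, by simp⟩, by simp [ht.ne']⟩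
  · refine (maxMixed_mem hn).1.add ?_
    rw [Matrix.IsHermitian, Matrix.conjTranspose_smul, hX.eq]
    simp
  · rw [Matrix.trace_add, (maxMixed_mem hn).2, Matrix.trace_smul, hX0]
    simp
  · rw [add_sub_cancel_left, hsNorm_real_smul, abs_of_pos (by positivity),
      inv_mul_le_iff₀ ht]
    rwa [div_le_iff₀ hr] at hXt

theorem gauge_recenter_le (hn : n ≠ 0) (hr : 0 < r) (hK : hsBall (maxMixed n) r ⊆ K) {X : Mat n}
    (hX : X.IsHermitian) (hX0 : X.trace = 0) : gauge (recenter K) X ≤ hsNorm X / r := by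
  refine le_of_forall_pos_le_add fun ε hε => ?_
  have := hsNorm_nonneg X
  have ht : 0 < hsNorm X / r + ε := by positivity
  exact gauge_le_of_mem ht.le (mem_smul_recenter hn hr hK hX hX0 ht (by linarith))

/-- Subadditivity of the gauge on traceless Hermitian matrices. The set `K₀` is absorbent only in
that subspace, so `gauge_add_le` does not apply. -/
theorem gauge_recenter_add_le (hn : n ≠ 0) (hr : 0 < r) (hK : hsBall (maxMixed n) r ⊆ K)
    (hconv : Convex ℝ K) {X Y : Mat n} (hX : X.IsHermitian) (hX0 : X.trace = 0)
    (hY : Y.IsHermitian) (hY0 : Y.trace = 0) :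
    gauge (recenter K) (X + Y) ≤ gauge (recenter K) X + gauge (recenter K) Y := by
  have hconv' : Convex ℝ (recenter K) := by
    have : recenter K = (fun A => -maxMixed n + A) '' K := by
      simp only [recenter, sub_eq_neg_add]
    rw [this]
    exact hconv.translate _
  have approx : ∀ {X : Mat n}, X.IsHermitian → X.trace = 0 → ∀ {ε : ℝ}, 0 < ε →
      ∃ t : ℝ, 0 < t ∧ X ∈ t • recenter K ∧ t < gauge (recenter K) X + ε := by
    intro X hX hX0 ε hε
    have hne : {t : ℝ | t ∈ Set.Ioi 0 ∧ X ∈ t • recenter K}.Nonempty := by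
      have := hsNorm_nonneg X
      have ht : 0 < hsNorm X / r + 1 := by positivity
      exact ⟨_, ht, mem_smul_recenter hn hr hK hX hX0 ht (by linarith)⟩
    obtain ⟨t, ht, hlt⟩ := exists_lt_of_csInf_lt hne
      (show sInf _ < gauge (recenter K) X + ε by
        rw [← gauge_def]
        linarith)
    exact ⟨t, ht.1, ht.2, hlt⟩
  refine le_of_forall_pos_le_add fun ε hε => ?_
  obtain ⟨t, ht, hXt, hlt⟩ := approx hX hX0 (half_pos hε)
  obtain ⟨u, hu, hYu, hlu⟩ := approx hY hY0 (half_pos hε)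
  have hmem : X + Y ∈ (t + u) • recenter K := by
    rw [hconv'.add_smul ht.le hu.le]
    exact Set.add_mem_add hXt hYu
  linarith [gauge_le_of_mem (by positivity) hmem]

theorem gauge_recenter_sub_le (hn : n ≠ 0) (hr : 0 < r) (hK : hsBall (maxMixed n) r ⊆ K)
    (hconv : Convex ℝ K) {A B : Mat n} (hA : A ∈ saTraceOne n) (hB : B ∈ saTraceOne n) :
    gauge (recenter K) (A - maxMixed n) - gauge (recenter K) (B - maxMixed n) ≤
      hsNorm (A - B) / r := by
  have hI := maxMixed_mem hn
  have h1 : (A - B).IsHermitian := hA.1.sub hB.1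
  have h2 : (A - B).trace = 0 := by rw [Matrix.trace_sub, hA.2, hB.2, sub_self]
  have h3 := gauge_recenter_add_le hn hr hK hconv h1 h2 (hB.1.sub hI.1)
    (by rw [Matrix.trace_sub, hB.2, hI.2, sub_self])
  rw [sub_add_sub_cancel] at h3
  linarith [gauge_recenter_le hn hr hK h1 h2]

theorem continuousOn_gauge_recenter (hn : n ≠ 0) (hr : 0 < r) (hK : hsBall (maxMixed n) r ⊆ K)
    (hconv : Convex ℝ K) :
    ContinuousOn (fun A => gauge (recenter K) (A - maxMixed n)) (saTraceOne n) := by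
  intro B hB
  rw [ContinuousWithinAt, tendsto_iff_dist_tendsto_zero]
  have hlim : Filter.Tendsto (fun A : Mat n => hsNorm (A - B) / r)
      (nhdsWithin B (saTraceOne n)) (nhds 0) := by
    have hc : Continuous fun A : Mat n => hsNorm (A - B) / r :=
      (continuous_hsNorm.comp (continuous_id.sub continuous_const)).div_const r
    have := hc.tendsto B
    simp only [sub_self, hsNorm_zero, zero_div] at this
    exact this.mono_left nhdsWithin_le_nhds
  refine squeeze_zero' (.of_forall fun _ => dist_nonneg) ?_ hlim
  filter_upwards [self_mem_nhdsWithin] with A hA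
  rw [Real.dist_eq, abs_sub_le_iff]
  refine ⟨gauge_recenter_sub_le hn hr hK hconv hA hB,
    (gauge_recenter_sub_le hn hr hK hconv hB hA).trans_eq ?_⟩
  rw [← neg_sub, ← neg_one_smul ℝ, hsNorm_real_smul]
  simp

end Gauge

/-! ### Concentration of locally Lipschitz functions around the median -/

/-- Upper deviations of a function which is Lipschitz only outside a small exceptional set. -/
theorem sphereUniform_add_le_of_lipschitz_off {n s : ℕ} (hn : n ≠ 0) (hs : s ≠ 0)
    {G : Metric.sphere (0 : Bipartite n s) 1 → ℝ} (hG : Measurable G)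
    {bad : Set (Metric.sphere (0 : Bipartite n s) 1)} (hbad : MeasurableSet bad)
    (hbad' : sphereUniform n s bad ≤ 1 / 4) {R : ℝ} (hR : 0 < R)
    (hlip : ∀ ψ ∉ bad, ∀ φ ∉ bad, G ψ - G φ ≤ R * ‖(φ : Bipartite n s) - ψ‖)
    {M : ℝ} (hM : 1 / 2 ≤ sphereUniform n s {ψ | G ψ ≤ M}) {η : ℝ} (hη : 0 ≤ η) :
    sphereUniform n s {ψ | M + η ≤ G ψ} ≤ sphereUniform n s bad +
      16 * ENNReal.ofReal (Real.exp (-(n * s * (η / R) ^ 2 / 8))) := by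
  set A := {ψ | G ψ ≤ M} \ bad
  set B := {ψ | M + η ≤ G ψ} \ bad
  have hA : MeasurableSet A := (measurableSet_le hG measurable_const).diff hbad
  have hB : MeasurableSet B := (measurableSet_le measurable_const hG).diff hbad
  have hA4 : 1 ≤ 4 * sphereUniform n s A := by
    have h1 : 1 / 4 + 1 / 4 ≤ sphereUniform n s A + 1 / 4 := by
      calc (1 / 4 + 1 / 4 : ℝ≥0∞) = 1 / 2 := by
            rw [← ENNReal.toReal_eq_toReal_iff' (by simp) (by simp),
              ENNReal.toReal_add (by simp) (by simp)]
            norm_num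
        _ ≤ _ := hM
        _ ≤ sphereUniform n s (A ∪ bad) := measure_mono fun ψ hψ => by
            by_cases h : ψ ∈ bad
            · exact .inr h
            · exact .inl ⟨hψ, h⟩
        _ ≤ _ := (measure_union_le _ _).trans (by gcongr)
    have h2 := (ENNReal.add_le_add_iff_right (by simp)).1 h1
    rwa [ENNReal.div_le_iff_le_mul (by simp) (by simp), mul_comm] at h2
  have key := sphereUniform_mul_sphereUniform_le hn hs hA hB (δ := η / R) (by positivity) (by
    intro φ hφ ψ hψ
    rw [div_le_iff₀' hR]
    have h1 : G φ ≤ M := hφ.1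
    have h2 : M + η ≤ G ψ := hψ.1
    linarith [hlip ψ hψ.2 φ hφ.2])
  calc sphereUniform n s {ψ | M + η ≤ G ψ} ≤ sphereUniform n s (bad ∪ B) :=
        measure_mono fun ψ hψ => by
          by_cases h : ψ ∈ bad
          · exact .inl h
          · exact .inr ⟨hψ, h⟩
    _ ≤ sphereUniform n s bad + sphereUniform n s B := measure_union_le _ _
    _ ≤ sphereUniform n s bad + 4 * sphereUniform n s A * sphereUniform n s B := by
        gcongr
        exact le_mul_of_one_le_left zero_le hA4
    _ ≤ sphereUniform n s bad +
        4 * (4 * ENNReal.ofReal (Real.exp (-(n * s * (η / R) ^ 2 / 8)))) := by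
        rw [mul_assoc]
        gcongr
    _ = _ := by ring

/-- Two-sided concentration of the gauge of the reduced state around a median, on the sphere. -/
theorem sphereUniform_le_abs_gauge_sub {n s : ℕ} (hn : n ≠ 0) (hns : n ≤ s)
    (hexp : 8 * ENNReal.ofReal (Real.exp (-s)) ≤ 1 / 4) {K : Set (Mat n)} {r : ℝ} (hr : 0 < r)
    (hK : hsBall (maxMixed n) r ⊆ K) (hconv : Convex ℝ K)
    {F : Metric.sphere (0 : Bipartite n s) 1 → ℝ}
    (hF : ∀ ψ, F ψ = gauge (recenter K) (partialTrace (pureState (ψ : Bipartite n s)) - maxMixed n))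
    {M : ℝ} (hM1 : 1 / 2 ≤ sphereUniform n s {ψ | F ψ ≤ M})
    (hM2 : 1 / 2 ≤ sphereUniform n s {ψ | M ≤ F ψ}) {η : ℝ} (hη : 0 ≤ η) :
    sphereUniform n s {ψ | η ≤ |F ψ - M|} ≤
      2 * (8 * ENNReal.ofReal (Real.exp (-s)) +
        16 * ENNReal.ofReal (Real.exp (-(1 / 51200 * (n : ℝ) ^ 2 * s * r ^ 2 * η ^ 2)))) := by
  have hn' : (0 : ℝ) < n := by positivity
  have hs : s ≠ 0 := by omega
  have hsa : ∀ ψ : Metric.sphere (0 : Bipartite n s) 1,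
      partialTrace (pureState (ψ : Bipartite n s)) ∈ saTraceOne n := fun ψ =>
    partialTrace_pureState_mem (by simp)
  have hFm : Measurable F := by
    rw [funext hF]
    exact ((continuousOn_gauge_recenter hn hr hK hconv).comp_continuous
      ((continuous_partialTrace_pureState n s).comp continuous_subtype_val) hsa).measurable
  set bad : Set (Metric.sphere (0 : Bipartite n s) 1) := {ψ | 40 / √n ≤ ‖vecOp n s ψ‖}
  have hbad : MeasurableSet bad := (isClosed_le continuous_const
    ((continuous_vecOp n s).comp continuous_subtype_val).norm).measurableSet
  have hbad8 : sphereUniform n s bad ≤ 8 * ENNReal.ofReal (Real.exp (-s)) :=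
    sphereUniform_forty_div_sqrt_le_norm_vecOp hn hns
  set R : ℝ := 2 * (40 / √n) / r with hRdef
  have hR : 0 < R := by positivity
  have hlip : ∀ ψ ∉ bad, ∀ φ ∉ bad, F ψ - F φ ≤ R * ‖(φ : Bipartite n s) - ψ‖ := by
    intro ψ hψ φ hφ
    rw [hF, hF]
    refine (gauge_recenter_sub_le hn hr hK hconv (hsa ψ) (hsa φ)).trans ?_
    rw [hRdef, div_mul_eq_mul_div, norm_sub_rev]
    gcongr
    exact hsNorm_partialTrace_sub_le (not_le.1 hψ).le (not_le.1 hφ).le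
  have hrate : -((n : ℝ) * s * (η / R) ^ 2 / 8) =
      -(1 / 51200 * (n : ℝ) ^ 2 * s * r ^ 2 * η ^ 2) := by
    rw [hRdef]
    have hsq : √(n : ℝ) ^ 2 = n := Real.sq_sqrt hn'.le
    field_simp
    rw [hsq]
    ring
  have up := sphereUniform_add_le_of_lipschitz_off hn hs hFm hbad (hbad8.trans hexp) hR hlip hM1 hη
  have down := sphereUniform_add_le_of_lipschitz_off hn hs (G := fun ψ => -F ψ) hFm.neg hbad
    (hbad8.trans hexp) hR (fun ψ hψ φ hφ => by
      rw [norm_sub_rev]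
      linarith [hlip φ hφ ψ hψ]) (M := -M) (by simpa using hM2) hη
  rw [hrate] at up down
  calc sphereUniform n s {ψ | η ≤ |F ψ - M|} ≤
        sphereUniform n s ({ψ | M + η ≤ F ψ} ∪ {ψ | -M + η ≤ -F ψ}) :=
        measure_mono fun ψ (hψ : η ≤ |F ψ - M|) => by
          rcases le_abs'.1 hψ with h | h
          · exact .inr (show -M + η ≤ -F ψ by linarith)
          · exact .inl (show M + η ≤ F ψ by linarith)
    _ ≤ _ := (measure_union_le _ _).trans (add_le_add up down)
    _ ≤ _ := by
        rw [two_mul]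
        gcongr

/-- Events that are relatively closed in the hyperplane of self-adjoint matrices of trace one pass
from a random state of law `inducedMeasure n s` to the sphere. -/
theorem measure_le_sphereUniform_of_hasLaw {n s : ℕ} {Ω : Type*} [MeasurableSpace Ω]
    {P : Measure Ω} {ρ : Ω → Mat n} (hρ : HasLaw ρ (inducedMeasure n s) P) {T : Set (Mat n)}
    (hT : IsClosed (saTraceOne n ∩ T)) :
    P {ω | ρ ω ∈ T} ≤
      sphereUniform n s {ψ | partialTrace (pureState (ψ : Bipartite n s)) ∈ T} := by
  have hmeas : MeasurableSet ((saTraceOne n ∩ T) ∪ (saTraceOne n)ᶜ) :=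
    hT.measurableSet.union (isClosed_saTraceOne n).measurableSet.compl
  calc P {ω | ρ ω ∈ T} ≤ P.map ρ T := Measure.le_map_apply hρ.aemeasurable T
    _ = inducedMeasure n s T := by rw [hρ.map_eq]
    _ ≤ inducedMeasure n s ((saTraceOne n ∩ T) ∪ (saTraceOne n)ᶜ) :=
        measure_mono fun A hA => by
          by_cases h : A ∈ saTraceOne n
          · exact .inl ⟨h, hA⟩
          · exact .inr h
    _ ≤ _ := by
        have hm : Measurable fun ψ : Metric.sphere (0 : Bipartite n s) 1 =>
            partialTrace (pureState (ψ : Bipartite n s)) :=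
          ((continuous_partialTrace_pureState n s).comp continuous_subtype_val).measurable
        rw [inducedMeasure, Measure.map_apply hm hmeas]
        refine measure_mono fun ψ hψ => ?_
        have hsa : partialTrace (pureState (ψ : Bipartite n s)) ∈ saTraceOne n :=
          partialTrace_pureState_mem (by simp)
        rcases hψ with h | h
        · exact h.2
        · exact absurd hsa h

end RandomState

theorem mainTheorem6 :
    ∃ C c : ℝ, 0 < C ∧ 0 < c ∧
      ∀ (n s : ℕ), 2 ≤ n → n ≤ s →
      ∀ (K : Set (RandomState.Mat n)), RandomState.IsStateBody K →
      ∀ (r : ℝ), 0 < r → RandomState.IsInradiusAtMaxMixed K r →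
      ∀ {Ω : Type*} [MeasurableSpace Ω] (P : Measure Ω) (ρ : Ω → RandomState.Mat n),
        HasLaw ρ (RandomState.inducedMeasure n s) P →
      ∀ (M : ℝ),
        RandomState.IsMedian P
          (fun ω => gauge (RandomState.recenter K) (ρ ω - RandomState.maxMixed n)) M →
      ∀ (η : ℝ), 0 < η →
        P {ω | η ≤ |gauge (RandomState.recenter K) (ρ ω - RandomState.maxMixed n) - M|} ≤
          ENNReal.ofReal (C * (Real.exp (-(c * s)) +
            Real.exp (-(c * (n : ℝ) ^ 2 * s * r ^ 2 * η ^ 2)))) := by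
  refine ⟨32, 1 / 51200, by norm_num, by norm_num, ?_⟩
  intro n s hn hns K hK r hr hrK Ω _ P ρ hρ M hM η hη
  have hn0 : n ≠ 0 := by omega
  have hball := hrK.1.2
  have hcont := RandomState.continuousOn_gauge_recenter hn0 hr hball hK.convex
  have hclosed := RandomState.isClosed_saTraceOne n
  have hexp_le : Real.exp (-s) ≤ Real.exp (-(1 / 51200 * s)) := by
    gcongr
    linarith [Nat.cast_nonneg (α := ℝ) s]
  have hdev := RandomState.measure_le_sphereUniform_of_hasLaw hρ
    (T := {A | η ≤ |gauge (RandomState.recenter K) (A - RandomState.maxMixed n) - M|})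
    ((hcont.sub continuousOn_const).abs.preimage_isClosed_of_isClosed hclosed isClosed_Ici)
  refine hdev.trans ?_
  rcases le_or_gt (8 * ENNReal.ofReal (Real.exp (-s))) (1 / 4) with hexp | hexp
  · have hle := hM.1.trans (RandomState.measure_le_sphereUniform_of_hasLaw hρ
      (T := {A | gauge (RandomState.recenter K) (A - RandomState.maxMixed n) ≤ M})
      (hcont.preimage_isClosed_of_isClosed hclosed isClosed_Iic))
    have hge := hM.2.trans (RandomState.measure_le_sphereUniform_of_hasLaw hρ
      (T := {A | M ≤ gauge (RandomState.recenter K) (A - RandomState.maxMixed n)})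
      (hcont.preimage_isClosed_of_isClosed hclosed isClosed_Ici))
    refine (RandomState.sphereUniform_le_abs_gauge_sub hn0 hns hexp hr hball hK.convex
      (fun _ => rfl) hle hge hη.le).trans ?_
    rw [← ENNReal.ofReal_ofNat 8, ← ENNReal.ofReal_ofNat 16, ← ENNReal.ofReal_ofNat 2,
      ← ENNReal.ofReal_mul (by norm_num), ← ENNReal.ofReal_mul (by norm_num),
      ← ENNReal.ofReal_add (by positivity) (by positivity), ← ENNReal.ofReal_mul (by norm_num)]
    apply ENNReal.ofReal_le_ofReal
    linarith [Real.exp_pos (-(s : ℝ))]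
  -- For bounded `s` the right-hand side exceeds `1`.
  · refine (measure_mono (Set.subset_univ _)).trans
      ((RandomState.sphereUniform_univ_le_one n s).trans ?_)
    rw [ENNReal.one_le_ofReal]
    have h : 1 / 4 < 8 * Real.exp (-s) := by
      have h8 : (8 : ℝ≥0∞) * ENNReal.ofReal (Real.exp (-s)) =
          ENNReal.ofReal (8 * Real.exp (-s)) := by
        rw [ENNReal.ofReal_mul (by norm_num)]
        simp
      rw [h8, ENNReal.lt_ofReal_iff_toReal_lt (by simp)] at hexp
      simpa using hexp
    have := Real.exp_pos (-(1 / 51200 * (n : ℝ) ^ 2 * s * r ^ 2 * η ^ 2))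
    linarith
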